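/- For real numbers $0<\lambda<\mu<1$ let $T_0(x,y)=(\lambda x,\mu y)$ and $T_1(x,y)=(\mu x+1-\mu,\lambda y+1-\lambda)$, and let $A_{\lambda,\mu}\subset\mathbb R^2$ be the attractor of the iterated function system $\{T_0,T_1\}$, that is, the unique nonempty compact set $A$ with $A=T_0(A)\cup T_1(A)$. Theorem. There exist $\lambda,\mu$ with $0<\lambda<\mu<1$ and $\lambda+\mu>1$ such that $A_{\lambda,\mu}$ has box-counting dimension strictly greater than $1$, in the sense that already its lower box-counting dimension $$\underline{\dim}_B A_{\lambda,\mu}=\liminf_{\delta\to 0^+}\frac{\log N_\delta(A_{\lambda,\mu})}{-\log\delta}$$ is strictly greater than $1$, where $N_\delta(A)$ is the least number of axis-parallel closed squares of side $2\delta$ that cover $A$. In particular this holds for $(\lambda,\mu)=(0.4,0.9)$. -/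

import Mathlib

open Set Filter Topology

/-- The lower box-counting (Minkowski) dimension of a subset `A` of a metric space,
`liminf_{δ → 0+} log N_δ(A) / (-log δ)`, where `N_δ(A)` is the least number of closed balls of
radius `δ` that cover `A`. It takes values in the extended reals. In `ℝ × ℝ`, whose distance is the
sup distance, these balls are the axis-parallel closed squares of side `2 * δ`. -/
noncomputable def lowerBoxDim {X : Type*} [PseudoMetricSpace X] (A : Set X) : EReal :=
  liminf (fun δ : ℝ =>
    ENNReal.log ((Metric.externalCoveringNumber δ.toNNReal A : ℕ∞) : ENNReal)
      / ((-Real.log δ : ℝ) : EReal)) (𝓝[>] (0 : ℝ))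

/-- The map `T₀ (x, y) = (λ x, μ y)`. -/
def T₀ (lam mu : ℝ) (p : ℝ × ℝ) : ℝ × ℝ := (lam * p.1, mu * p.2)

/-- The map `T₁ (x, y) = (μ x + 1 - μ, λ y + 1 - λ)`. -/
def T₁ (lam mu : ℝ) (p : ℝ × ℝ) : ℝ × ℝ := (mu * p.1 + 1 - mu, lam * p.2 + 1 - lam)

/-- `A` is an attractor of the iterated function system `{T₀, T₁}`: a nonempty compact set with
`A = T₀(A) ∪ T₁(A)`. -/
structure IsAttractor (lam mu : ℝ) (A : Set (ℝ × ℝ)) : Prop where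
  isCompact : IsCompact A
  nonempty : A.Nonempty
  eq_union : A = T₀ lam mu '' A ∪ T₁ lam mu '' A

theorem continuous_T₀ (lam mu : ℝ) : Continuous (T₀ lam mu) := by
  unfold T₀; fun_prop

theorem continuous_T₁ (lam mu : ℝ) : Continuous (T₁ lam mu) := by
  unfold T₁; fun_prop

/-- For `0 < λ, μ < 1` an attractor exists. -/
theorem exists_isAttractor {lam mu : ℝ} (hl : 0 < lam) (hl' : lam < 1) (hm : 0 < mu)
    (hm' : mu < 1) : ∃ A, IsAttractor lam mu A := by
  let F : Set (ℝ × ℝ) → Set (ℝ × ℝ) := fun K => T₀ lam mu '' K ∪ T₁ lam mu '' K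
  let Q : Set (ℝ × ℝ) := Icc 0 1 ×ˢ Icc 0 1
  have hF : Monotone F := fun K L h => union_subset_union (image_mono h) (image_mono h)
  have hFQ : F Q ⊆ Q := by
    rintro p (⟨q, ⟨⟨h1, h2⟩, h3, h4⟩, rfl⟩ | ⟨q, ⟨⟨h1, h2⟩, h3, h4⟩, rfl⟩)
    · exact ⟨⟨by simp only [T₀]; positivity, by simp only [T₀]; nlinarith⟩,
        by simp only [T₀]; positivity, by simp only [T₀]; nlinarith⟩
    · exact ⟨⟨by simp only [T₁]; nlinarith, by simp only [T₁]; nlinarith⟩,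
        by simp only [T₁]; nlinarith, by simp only [T₁]; nlinarith⟩
  have hanti : Antitone fun n => F^[n] Q := hF.antitone_iterate_of_map_le hFQ
  have hc : ∀ n, IsCompact (F^[n] Q) := by
    intro n
    induction n with
    | zero => exact isCompact_Icc.prod isCompact_Icc
    | succ n ih =>
      rw [Function.iterate_succ_apply']
      exact (ih.image (continuous_T₀ lam mu)).union (ih.image (continuous_T₁ lam mu))
  have hne : ∀ n, (F^[n] Q).Nonempty := by
    intro n
    induction n with
    | zero => exact ⟨(0, 0), by simp [Q]⟩
    | succ n ih =>
      rw [Function.iterate_succ_apply']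
      exact (ih.image _).inl
  have hi0 : Function.Injective (T₀ lam mu) := by
    rintro ⟨a, b⟩ ⟨c, d⟩ h
    simp only [T₀, Prod.mk.injEq, mul_eq_mul_left_iff, hl.ne', hm.ne', or_false] at h
    exact Prod.ext h.1 h.2
  have hi1 : Function.Injective (T₁ lam mu) := by
    rintro ⟨a, b⟩ ⟨c, d⟩ h
    simp only [T₁, Prod.mk.injEq, sub_left_inj, add_left_inj, mul_eq_mul_left_iff, hl.ne', hm.ne',
      or_false] at h
    exact Prod.ext h.1 h.2
  refine ⟨⋂ n, F^[n] Q, ?_, ?_, ?_⟩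
  · exact (hc 0).of_isClosed_subset (isClosed_iInter fun n => (hc n).isClosed) (iInter_subset _ 0)
  · exact IsCompact.nonempty_iInter_of_sequence_nonempty_isCompact_isClosed _
      (fun n => hanti n.le_succ) hne (hc 0) fun n => (hc n).isClosed
  · rw [hi0.injOn.image_iInter_eq, hi1.injOn.image_iInter_eq,
      ← iInter_union_of_antitone (fun m n h => image_mono (hanti h))
        fun m n h => image_mono (hanti h)]
    have h1 : ∀ n, T₀ lam mu '' (F^[n] Q) ∪ T₁ lam mu '' (F^[n] Q) = F^[n + 1] Q := fun n => by
      rw [Function.iterate_succ_apply']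
    simp_rw [h1]
    exact Subset.antisymm (subset_iInter fun n => iInter_subset _ (n + 1))
      (iInter_mono fun n => hanti n.le_succ)

theorem IsAttractor.subset {lam mu : ℝ} (hl : 0 < lam) (hl' : lam < 1) (hm : 0 < mu)
    (hm' : mu < 1) {A B : Set (ℝ × ℝ)} (hA : IsAttractor lam mu A) (hB : IsAttractor lam mu B) :
    A ⊆ B := by
  obtain ⟨x, hx, hmax⟩ := hA.isCompact.exists_isMaxOn hA.nonempty
    (Metric.continuous_infDist_pt B).continuousOn
  have key : ∀ T : ℝ × ℝ → ℝ × ℝ, (∀ p q, dist (T p) (T q) ≤ max lam mu * dist p q) →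
      (∀ b ∈ B, T b ∈ B) → ∀ a, Metric.infDist (T a) B ≤ max lam mu * Metric.infDist a B := by
    intro T hT hTB a
    obtain ⟨b, hb, hab⟩ := hB.isCompact.exists_infDist_eq_dist hB.nonempty a
    rw [hab]
    exact (Metric.infDist_le_dist_of_mem (hTB b hb)).trans (hT a b)
  have h0 : ∀ a, Metric.infDist (T₀ lam mu a) B ≤ max lam mu * Metric.infDist a B := by
    refine key _ (fun p q => ?_) fun b hb => hB.eq_union ▸ Or.inl (mem_image_of_mem _ hb)
    simp only [T₀, Prod.dist_eq, Real.dist_eq, ← mul_sub, abs_mul, abs_of_pos hl, abs_of_pos hm]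
    exact max_le (by gcongr; exacts [le_max_left _ _, le_max_left _ _])
      (by gcongr; exacts [le_max_right _ _, le_max_right _ _])
  have h1 : ∀ a, Metric.infDist (T₁ lam mu a) B ≤ max lam mu * Metric.infDist a B := by
    refine key _ (fun p q => ?_) fun b hb => hB.eq_union ▸ Or.inr (mem_image_of_mem _ hb)
    simp only [T₁, Prod.dist_eq, Real.dist_eq, sub_sub_sub_cancel_right, add_sub_add_right_eq_sub,
      ← mul_sub, abs_mul, abs_of_pos hl, abs_of_pos hm]
    exact max_le (by gcongr; exacts [le_max_right _ _, le_max_left _ _])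
      (by gcongr; exacts [le_max_left _ _, le_max_right _ _])
  have hle : Metric.infDist x B ≤ max lam mu * Metric.infDist x B := by
    have hx' := hx
    rw [hA.eq_union] at hx'
    have hnn : 0 ≤ max lam mu := hl.le.trans (le_max_left _ _)
    rcases hx' with ⟨a, ha, hax⟩ | ⟨a, ha, hax⟩
    · have h2 := h0 a
      rw [hax] at h2
      exact h2.trans (mul_le_mul_of_nonneg_left (hmax ha) hnn)
    · have h2 := h1 a
      rw [hax] at h2
      exact h2.trans (mul_le_mul_of_nonneg_left (hmax ha) hnn)
  have hx0 : Metric.infDist x B ≤ 0 := by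
    have : max lam mu < 1 := max_lt hl' hm'
    nlinarith
  intro a ha
  have ha0 : Metric.infDist a B = 0 :=
    le_antisymm ((show Metric.infDist a B ≤ Metric.infDist x B from hmax ha).trans hx0)
      Metric.infDist_nonneg
  exact (hB.isCompact.isClosed.mem_iff_infDist_zero hB.nonempty).2 ha0

/-- For `0 < λ, μ < 1` there is exactly one attractor. -/
theorem existsUnique_isAttractor {lam mu : ℝ} (hl : 0 < lam) (hl' : lam < 1) (hm : 0 < mu)
    (hm' : mu < 1) : ∃! A, IsAttractor lam mu A := by
  obtain ⟨A, hA⟩ := exists_isAttractor hl hl' hm hm'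
  exact ⟨A, hA, fun B hB => (hB.subset hl hl' hm hm' hA).antisymm (hA.subset hl hl' hm hm' hB)⟩

open Classical in
/-- The attractor `A_{λ,μ}` of `{T₀, T₁}`: the unique nonempty compact set `A` with
`A = T₀(A) ∪ T₁(A)` if `0 < λ, μ < 1`, and a default value if there is no such set. -/
noncomputable def attractor (lam mu : ℝ) : Set (ℝ × ℝ) :=
  if h : ∃ A, IsAttractor lam mu A then h.choose else ∅

theorem isAttractor_attractor {lam mu : ℝ} (hl : 0 < lam) (hl' : lam < 1) (hm : 0 < mu)
    (hm' : mu < 1) : IsAttractor lam mu (attractor lam mu) := by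
  have h := exists_isAttractor hl hl' hm hm'
  rw [attractor, dif_pos h]
  exact h.choose_spec

/-!
For `(λ, μ) = (0.4, 0.9)` two words already generate a subsystem that is separated and yet wide:
`T₀ ∘ T₁` and `T₁ ∘ T₁ ∘ T₁` scale the width by `λμ = 0.36` and `μ³ = 0.729`, so the widths of the
two images of the unit square add up to `θ = λμ + μ³ = 1.089 > 1`, while the images lie at heights
at most `μ = 0.9` and at least `1 - λ³ = 0.936` respectively, hence are disjoint.

Consider covers of the attractor by closed boxes of half-width `w` and half-height `h`, both kept as
independent parameters because the maps scale the two coordinates differently.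

* Since `λ + μ ≥ 1`, the horizontal projection of the attractor contains `[0, 1]`, so every such
  cover has at least `1 / (2w)` boxes, whatever `h` is (`IsAttractor.one_le_of_isBoxCover`).
* If `2h` is less than the vertical gap `1 - λ³ - μ`, no box meets both images. Pulling back the
  boxes that meet one image under the corresponding map gives a cover of the whole attractor with
  half-width `w / (λμ)`, resp. `w / μ³`. So each step down in height, by the smallest vertical
  factor `λ³`, multiplies the lower bound by `θ`: if `2h < (1 - λ³ - μ) (λ³)ⁿ`, at least
  `θⁿ / (2w)` boxes are needed (`IsAttractor.pow_le_of_isBoxCover`).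

With `w = h = δ` the exponent `n` can be taken proportional to `-log δ`, which yields
`N_δ ≥ δ ^ -(1 + η)` for some `η > 0` and all small `δ`
(`IsAttractor.one_lt_lowerBoxDim`).
-/

/-! ### Covers by boxes -/

/-- The finitely many closed boxes with half-width `w`, half-height `h` and centres in `F` cover
`A`. -/
def IsBoxCover (A : Set (ℝ × ℝ)) (w h : ℝ) (F : Finset (ℝ × ℝ)) : Prop :=
  ∀ p ∈ A, ∃ c ∈ F, |p.1 - c.1| ≤ w ∧ |p.2 - c.2| ≤ h

/-- A box cover of the image of `A` under a diagonal affine map pulls back to a box cover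
of `A`. -/
theorem exists_isBoxCover_of_affine {A : Set (ℝ × ℝ)} {w h a b u v : ℝ} (ha : 0 < a) (hb : 0 < b)
    {G : Finset (ℝ × ℝ)}
    (hG : ∀ p ∈ A, ∃ c ∈ G, |a * p.1 + u - c.1| ≤ w ∧ |b * p.2 + v - c.2| ≤ h) :
    ∃ F : Finset (ℝ × ℝ), F.card ≤ G.card ∧ IsBoxCover A (w / a) (h / b) F := by
  classical
  have key : ∀ {a : ℝ} (x u c w : ℝ), 0 < a → |a * x + u - c| ≤ w → |x - (c - u) / a| ≤ w / a := by
    intro a x u c w ha hw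
    have h1 : x - (c - u) / a = (a * x + u - c) / a := by field_simp; ring
    rw [h1, abs_div, abs_of_pos ha]
    gcongr
  refine ⟨G.image fun c => ((c.1 - u) / a, (c.2 - v) / b), Finset.card_image_le, fun p hp => ?_⟩
  obtain ⟨c, hc, h1, h2⟩ := hG p hp
  exact ⟨_, Finset.mem_image_of_mem _ hc, key _ _ _ _ ha h1, key _ _ _ _ hb h2⟩

/-- Finitely many intervals of length `2 * w` covering `[0, 1]` have total length at least `1`. -/
theorem one_le_of_cover_unitInterval {w : ℝ} {F : Finset (ℝ × ℝ)}
    (hF : ∀ x ∈ Icc (0 : ℝ) 1, ∃ c ∈ F, |x - c.1| ≤ w) : 1 ≤ 2 * w * F.card := by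
  have hw : 0 ≤ w := by
    obtain ⟨c, -, hc⟩ := hF 0 (by simp)
    exact (abs_nonneg _).trans hc
  have hsub : Icc (0 : ℝ) 1 ⊆ ⋃ c ∈ F, Icc (c.1 - w) (c.1 + w) := by
    intro x hx
    obtain ⟨c, hc, h⟩ := hF x hx
    rw [abs_le] at h
    exact mem_iUnion₂.2 ⟨c, hc, by linarith, by linarith⟩
  have h1 := (MeasureTheory.measure_mono (μ := MeasureTheory.volume) hsub).trans
    (MeasureTheory.measure_biUnion_finset_le F _)
  have h2 : ∀ c : ℝ × ℝ, c.1 + w - (c.1 - w) = 2 * w := fun c => by ring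
  simp only [Real.volume_Icc, h2, Finset.sum_const, nsmul_eq_mul] at h1
  rw [sub_zero, ← ENNReal.ofReal_natCast, ← ENNReal.ofReal_mul (by positivity),
    ENNReal.ofReal_le_ofReal_iff (by positivity)] at h1
  linarith

/-! ### Position of the attractor -/

section Attractor

variable {lam mu : ℝ} {A : Set (ℝ × ℝ)}

theorem IsAttractor.T₀_mem (hA : IsAttractor lam mu A) {p : ℝ × ℝ} (hp : p ∈ A) :
    T₀ lam mu p ∈ A :=
  hA.eq_union ▸ Or.inl (mem_image_of_mem _ hp)

theorem IsAttractor.T₁_mem (hA : IsAttractor lam mu A) {p : ℝ × ℝ} (hp : p ∈ A) :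
    T₁ lam mu p ∈ A :=
  hA.eq_union ▸ Or.inr (mem_image_of_mem _ hp)

theorem IsAttractor.snd_le_one (hA : IsAttractor lam mu A) (hl' : lam < 1)
    (hl : 0 < lam) (hm : 0 < mu) (hm' : mu < 1) {p : ℝ × ℝ} (hp : p ∈ A) : p.2 ≤ 1 := by
  obtain ⟨x, hx, hmax⟩ := hA.isCompact.exists_isMaxOn hA.nonempty continuous_snd.continuousOn
  refine (show p.2 ≤ x.2 from hmax hp).trans ?_
  have hx' := hx
  rw [hA.eq_union] at hx'
  rcases hx' with ⟨a, ha, rfl⟩ | ⟨a, ha, rfl⟩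
  · have h : a.2 ≤ mu * a.2 := hmax ha
    simp only [T₀]
    nlinarith
  · have h : a.2 ≤ lam * a.2 + 1 - lam := hmax ha
    simp only [T₁]
    nlinarith

theorem IsAttractor.snd_nonneg (hA : IsAttractor lam mu A) (hl' : lam < 1)
    (hl : 0 < lam) (hm : 0 < mu) (hm' : mu < 1) {p : ℝ × ℝ} (hp : p ∈ A) : 0 ≤ p.2 := by
  obtain ⟨x, hx, hmin⟩ := hA.isCompact.exists_isMinOn hA.nonempty continuous_snd.continuousOn
  refine le_trans ?_ (show x.2 ≤ p.2 from hmin hp)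
  have hx' := hx
  rw [hA.eq_union] at hx'
  rcases hx' with ⟨a, ha, rfl⟩ | ⟨a, ha, rfl⟩
  · have h : mu * a.2 ≤ a.2 := hmin ha
    simp only [T₀]
    nlinarith
  · have h : lam * a.2 + 1 - lam ≤ a.2 := hmin ha
    simp only [T₁]
    nlinarith

/-- If `λ + μ ≥ 1`, the horizontal projection of the attractor contains `[0, 1]`: the interval is
covered by its own images under `x ↦ λ x` and `x ↦ μ x + 1 - μ`, so its largest distance to the
projection is contracted by the factor `max λ μ` and must vanish. -/
theorem IsAttractor.unitInterval_subset_image_fst (hA : IsAttractor lam mu A) (hl : 0 < lam)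
    (hl' : lam < 1) (hm : 0 < mu) (hm' : mu < 1) (hlm : 1 ≤ lam + mu) :
    Icc (0 : ℝ) 1 ⊆ Prod.fst '' A := by
  set P : Set ℝ := Prod.fst '' A with hP
  have hPc : IsCompact P := hA.isCompact.image continuous_fst
  have hPn : P.Nonempty := hA.nonempty.image _
  have hP0 : ∀ x ∈ P, lam * x ∈ P := by
    rintro _ ⟨p, hp, rfl⟩
    exact ⟨_, hA.T₀_mem hp, rfl⟩
  have hP1 : ∀ x ∈ P, mu * x + 1 - mu ∈ P := by
    rintro _ ⟨p, hp, rfl⟩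
    exact ⟨_, hA.T₁_mem hp, rfl⟩
  obtain ⟨x, hx, hmax⟩ := (isCompact_Icc (a := (0 : ℝ)) (b := 1)).exists_isMaxOn
    ⟨0, by simp⟩ (Metric.continuous_infDist_pt P).continuousOn
  have hcontr : Metric.infDist x P ≤ max lam mu * Metric.infDist x P := by
    rcases le_total x lam with h | h
    · have hu : x / lam ∈ Icc (0 : ℝ) 1 :=
        ⟨div_nonneg hx.1 hl.le, (div_le_one hl).2 h⟩
      obtain ⟨y, hy, hxy⟩ := hPc.exists_infDist_eq_dist hPn (x / lam)
      calc Metric.infDist x P ≤ dist x (lam * y) := Metric.infDist_le_dist_of_mem (hP0 y hy)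
        _ = lam * dist (x / lam) y := by
          rw [Real.dist_eq, Real.dist_eq, ← abs_of_pos hl, ← abs_mul, abs_of_pos hl]
          congr 1
          field_simp
        _ = lam * Metric.infDist (x / lam) P := by rw [hxy]
        _ ≤ max lam mu * Metric.infDist x P :=
          mul_le_mul (le_max_left _ _) (hmax hu) Metric.infDist_nonneg
            (hl.le.trans (le_max_left _ _))
    · have hu : (x - (1 - mu)) / mu ∈ Icc (0 : ℝ) 1 :=
        ⟨div_nonneg (by linarith) hm.le, (div_le_one hm).2 (by linarith [hx.2])⟩
      obtain ⟨y, hy, hxy⟩ := hPc.exists_infDist_eq_dist hPn ((x - (1 - mu)) / mu)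
      calc Metric.infDist x P ≤ dist x (mu * y + 1 - mu) :=
            Metric.infDist_le_dist_of_mem (hP1 y hy)
        _ = mu * dist ((x - (1 - mu)) / mu) y := by
          rw [Real.dist_eq, Real.dist_eq, ← abs_of_pos hm, ← abs_mul, abs_of_pos hm]
          congr 1
          field_simp
          ring
        _ = mu * Metric.infDist ((x - (1 - mu)) / mu) P := by rw [hxy]
        _ ≤ max lam mu * Metric.infDist x P :=
          mul_le_mul (le_max_right _ _) (hmax hu) Metric.infDist_nonneg
            (hl.le.trans (le_max_left _ _))
  have h0 : Metric.infDist x P ≤ 0 := by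
    have : max lam mu < 1 := max_lt hl' hm'
    nlinarith
  intro z hz
  have hz0 : Metric.infDist z P = 0 :=
    le_antisymm ((show Metric.infDist z P ≤ Metric.infDist x P from hmax hz).trans h0)
      Metric.infDist_nonneg
  exact (hPc.isClosed.mem_iff_infDist_zero hPn).2 hz0

/-! ### Lower bounds for box covers -/

theorem IsAttractor.one_le_of_isBoxCover (hA : IsAttractor lam mu A) (hl : 0 < lam)
    (hl' : lam < 1) (hm : 0 < mu) (hm' : mu < 1) (hlm : 1 ≤ lam + mu) {w h : ℝ}
    {F : Finset (ℝ × ℝ)} (hF : IsBoxCover A w h F) : 1 ≤ 2 * w * F.card := by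
  refine one_le_of_cover_unitInterval fun x hx => ?_
  obtain ⟨p, hp, rfl⟩ := hA.unitInterval_subset_image_fst hl hl' hm hm' hlm hx
  obtain ⟨c, hc, h1, -⟩ := hF p hp
  exact ⟨c, hc, h1⟩

/-- Boxes lower than the vertical gap between `T₀ (T₁ A)` and `T₁ (T₁ (T₁ A))` split into two
disjoint families, each of which pulls back to a cover of `A`. -/
theorem IsAttractor.exists_isBoxCover_add_card_le (hA : IsAttractor lam mu A) (hl : 0 < lam)
    (hl' : lam < 1) (hm : 0 < mu) (hm' : mu < 1) {w h : ℝ} (hh : 2 * h < 1 - lam ^ 3 - mu)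
    {F : Finset (ℝ × ℝ)} (hF : IsBoxCover A w h F) :
    ∃ F₁ F₂ : Finset (ℝ × ℝ), F₁.card + F₂.card ≤ F.card ∧
      IsBoxCover A (w / (lam * mu)) (h / (lam * mu)) F₁ ∧
      IsBoxCover A (w / mu ^ 3) (h / lam ^ 3) F₂ := by
  classical
  let G₁ := F.filter fun c => ∃ p ∈ A, |lam * mu * p.2 + mu * (1 - lam) - c.2| ≤ h
  let G₂ := F.filter fun c => ∃ p ∈ A, |lam ^ 3 * p.2 + (1 - lam ^ 3) - c.2| ≤ h
  have hdisj : Disjoint G₁ G₂ := by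
    rw [Finset.disjoint_left]
    intro c h1 h2
    obtain ⟨-, p, hp, hpc⟩ := Finset.mem_filter.1 h1
    obtain ⟨-, q, hq, hqc⟩ := Finset.mem_filter.1 h2
    have hp1 := mul_le_mul_of_nonneg_left (hA.snd_le_one hl' hl hm hm' hp) (mul_pos hl hm).le
    have hq0 := mul_nonneg (pow_pos hl 3).le (hA.snd_nonneg hl' hl hm hm' hq)
    rw [abs_le] at hpc hqc
    linarith [hpc.1, hqc.2]
  have hcard : G₁.card + G₂.card ≤ F.card := by
    rw [← Finset.card_union_of_disjoint hdisj]
    exact Finset.card_le_card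
      (Finset.union_subset (Finset.filter_subset _ _) (Finset.filter_subset _ _))
  obtain ⟨F₁, hF₁, hc₁⟩ := exists_isBoxCover_of_affine (A := A) (w := w) (h := h) (G := G₁)
    (u := lam * (1 - mu)) (v := mu * (1 - lam)) (mul_pos hl hm) (mul_pos hl hm) fun p hp => by
      obtain ⟨c, hc, h1, h2⟩ := hF _ (hA.T₀_mem (hA.T₁_mem hp))
      have e1 : (T₀ lam mu (T₁ lam mu p)).1 = lam * mu * p.1 + lam * (1 - mu) := by
        simp only [T₀, T₁]; ring
      have e2 : (T₀ lam mu (T₁ lam mu p)).2 = lam * mu * p.2 + mu * (1 - lam) := by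
        simp only [T₀, T₁]; ring
      rw [e1] at h1
      rw [e2] at h2
      exact ⟨c, Finset.mem_filter.2 ⟨hc, p, hp, h2⟩, h1, h2⟩
  obtain ⟨F₂, hF₂, hc₂⟩ := exists_isBoxCover_of_affine (A := A) (w := w) (h := h) (G := G₂)
    (u := 1 - mu ^ 3) (v := 1 - lam ^ 3) (pow_pos hm 3) (pow_pos hl 3) fun p hp => by
      obtain ⟨c, hc, h1, h2⟩ := hF _ (hA.T₁_mem (hA.T₁_mem (hA.T₁_mem hp)))
      have e1 : (T₁ lam mu (T₁ lam mu (T₁ lam mu p))).1 = mu ^ 3 * p.1 + (1 - mu ^ 3) := by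
        simp only [T₁]; ring
      have e2 : (T₁ lam mu (T₁ lam mu (T₁ lam mu p))).2 = lam ^ 3 * p.2 + (1 - lam ^ 3) := by
        simp only [T₁]; ring
      rw [e1] at h1
      rw [e2] at h2
      exact ⟨c, Finset.mem_filter.2 ⟨hc, p, hp, h2⟩, h1, h2⟩
  exact ⟨F₁, F₂, by omega, hc₁, hc₂⟩

/-- Boxes of half-width `w` and of height less than `(1 - λ³ - μ) (λ³)ⁿ` that cover the attractor
have total width at least `(λμ + μ³)ⁿ`. -/
theorem IsAttractor.pow_le_of_isBoxCover (hA : IsAttractor lam mu A) (hl : 0 < lam)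
    (hlm' : lam < mu) (hm' : mu < 1) (hlm : 1 ≤ lam + mu) (n : ℕ) {w h : ℝ}
    (hh0 : 0 < h) (hh : 2 * h < (1 - lam ^ 3 - mu) * (lam ^ 3) ^ n) {F : Finset (ℝ × ℝ)}
    (hF : IsBoxCover A w h F) : (lam * mu + mu ^ 3) ^ n ≤ 2 * w * F.card := by
  have hm : 0 < mu := hl.trans hlm'
  have hl' : lam < 1 := hlm'.trans hm'
  have hl3 : 0 < lam ^ 3 := pow_pos hl 3
  have hm3 : 0 < mu ^ 3 := pow_pos hm 3
  have hab : 0 < lam * mu := mul_pos hl hm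
  induction n generalizing w h F with
  | zero => simpa using hA.one_le_of_isBoxCover hl hl' hm hm' hlm hF
  | succ n ih =>
    have hpow : 0 < (lam ^ 3) ^ (n + 1) := pow_pos hl3 _
    have hgap : 0 < 1 - lam ^ 3 - mu := by
      by_contra hneg
      nlinarith
    have hle1 : (lam ^ 3) ^ (n + 1) ≤ 1 := pow_le_one₀ hl3.le (pow_le_one₀ hl.le hl'.le)
    obtain ⟨F₁, F₂, hcard, hc₁, hc₂⟩ := hA.exists_isBoxCover_add_card_le hl hl' hm hm'
      (show 2 * h < 1 - lam ^ 3 - mu by nlinarith) hF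
    have hw : 0 ≤ w := by
      obtain ⟨p, hp⟩ := hA.nonempty
      obtain ⟨c, -, hc, -⟩ := hF p hp
      exact (abs_nonneg _).trans hc
    have hh₂ : 2 * (h / lam ^ 3) < (1 - lam ^ 3 - mu) * (lam ^ 3) ^ n := by
      rw [← mul_div_assoc, div_lt_iff₀ hl3]
      linarith [pow_succ (lam ^ 3) n, congrArg ((1 - lam ^ 3 - mu) * ·) (pow_succ (lam ^ 3) n)]
    have hh₁ : 2 * (h / (lam * mu)) < (1 - lam ^ 3 - mu) * (lam ^ 3) ^ n := by
      refine lt_of_le_of_lt ?_ hh₂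
      have : lam ^ 3 ≤ lam * mu := by
        rw [pow_succ' lam 2]
        exact mul_le_mul_of_nonneg_left (by nlinarith) hl.le
      gcongr
    have h₁ := ih (div_pos hh0 hab) hh₁ hc₁
    have h₂ := ih (div_pos hh0 hl3) hh₂ hc₂
    have h₁' : lam * mu * (lam * mu + mu ^ 3) ^ n ≤ 2 * w * F₁.card := by
      calc _ ≤ lam * mu * (2 * (w / (lam * mu)) * F₁.card) := by gcongr
        _ = 2 * w * F₁.card := by field_simp
    have h₂' : mu ^ 3 * (lam * mu + mu ^ 3) ^ n ≤ 2 * w * F₂.card := by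
      calc _ ≤ mu ^ 3 * (2 * (w / mu ^ 3) * F₂.card) := by gcongr
        _ = 2 * w * F₂.card := by field_simp
    have hcard' : (F₁.card + F₂.card : ℝ) ≤ F.card := mod_cast hcard
    calc (lam * mu + mu ^ 3) ^ (n + 1)
        = lam * mu * (lam * mu + mu ^ 3) ^ n + mu ^ 3 * (lam * mu + mu ^ 3) ^ n := by ring
      _ ≤ 2 * w * (F₁.card + F₂.card) := by linarith
      _ ≤ 2 * w * F.card := by gcongr

end Attractor

/-! ### The box dimension -/

/-- If every finite cover by balls of radius `δ` has at least `δ ^ (-s)` elements, for all small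
`δ`, then the lower box dimension is at least `s`. -/
theorem le_lowerBoxDim {X : Type*} [PseudoMetricSpace X] {A : Set X} {s : ℝ}
    (hs : ∀ᶠ δ : ℝ in 𝓝[>] 0, ∀ F : Finset X, (∀ p ∈ A, ∃ c ∈ F, dist p c ≤ δ) →
      s * -Real.log δ ≤ Real.log F.card ∧ 0 < F.card) :
    (s : EReal) ≤ lowerBoxDim A := by
  refine le_liminf_of_le (by isBoundedDefault) ?_
  filter_upwards [hs, self_mem_nhdsWithin, Ioo_mem_nhdsGT (zero_lt_one (α := ℝ))]
    with δ hδ hpos hlt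
  have hlog : 0 < -Real.log δ := neg_pos.2 (Real.log_neg hpos hlt.2)
  rw [EReal.le_div_iff_mul_le (EReal.coe_pos.2 hlog) (EReal.coe_ne_top _)]
  by_cases htop : Metric.externalCoveringNumber δ.toNNReal A = ⊤
  · simp [htop]
  have : Nonempty {C : Set X // Metric.IsCover δ.toNNReal A C} :=
    ⟨⟨A, Metric.IsCover.refl _ _⟩⟩
  obtain ⟨C, hC⟩ := ENat.exists_eq_iInf
    (fun C : {C : Set X // Metric.IsCover δ.toNNReal A C} => (C : Set X).encard)
  have hN : Metric.externalCoveringNumber δ.toNNReal A = (C : Set X).encard := by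
    rw [hC, Metric.externalCoveringNumber, iInf_subtype]
  rw [hN] at htop ⊢
  have hfin : (C : Set X).Finite := Set.encard_ne_top_iff.1 htop
  obtain ⟨h1, h2⟩ := hδ hfin.toFinset fun p hp => by
    have h := mem_iUnion₂.1 (C.2.subset_iUnion_closedBall hp)
    obtain ⟨c, hc, hpc⟩ := h
    exact ⟨c, hfin.mem_toFinset.2 hc, by simpa [Real.coe_toNNReal _ (le_of_lt hpos)] using hpc⟩
  rw [hfin.encard_eq_coe_toFinset_card]
  have h3 : ENNReal.log (((hfin.toFinset.card : ℕ∞)) : ENNReal) = Real.log hfin.toFinset.card := by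
    rw [ENat.toENNReal_coe, ← ENNReal.ofReal_natCast, ENNReal.log_ofReal_of_pos (mod_cast h2)]
  rw [h3]
  exact_mod_cast h1

/-- The lower box dimension exceeds `1` as soon as the images of the unit square under `T₀ ∘ T₁` and
`T₁ ∘ T₁ ∘ T₁` are vertically separated (`λ³ + μ < 1`) and have total width greater than `1`. -/
theorem IsAttractor.one_lt_lowerBoxDim {lam mu : ℝ} {A : Set (ℝ × ℝ)}
    (hA : IsAttractor lam mu A) (hl : 0 < lam) (hlm' : lam < mu) (hm' : mu < 1)
    (hlm : 1 ≤ lam + mu) (hgap : lam ^ 3 + mu < 1) (hwidth : 1 < lam * mu + mu ^ 3) :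
    1 < lowerBoxDim A := by
  set θ := lam * mu + mu ^ 3 with hθ
  set β := lam ^ 3 with hβ
  set ρ := (1 - β - mu) / 2 with hρ
  have hρ0 : 0 < ρ := by rw [hρ]; linarith
  have hβ0 : 0 < β := pow_pos hl 3
  have hβ1 : β < 1 := by linarith
  have hL : 0 < -Real.log β := neg_pos.2 (Real.log_neg hβ0 hβ1)
  have hT : 0 < Real.log θ := Real.log_pos hwidth
  set t := Real.log θ / -Real.log β with ht
  have ht0 : 0 < t := div_pos hT hL
  -- Half of the gain `t` in the exponent absorbs the multiplicative constants.
  suffices h : ((1 + t / 2 : ℝ) : EReal) ≤ lowerBoxDim A by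
    refine lt_of_lt_of_le ?_ h
    exact_mod_cast (by linarith : (1 : ℝ) < 1 + t / 2)
  refine le_lowerBoxDim ?_
  have hbig : Tendsto (fun δ : ℝ => -Real.log δ) (𝓝[>] 0) atTop :=
    tendsto_neg_atBot_atTop.comp Real.tendsto_log_nhdsGT_zero
  filter_upwards [self_mem_nhdsWithin,
    hbig.eventually_ge_atTop ((Real.log θ - t * Real.log ρ + Real.log 2) / (t / 2)),
    hbig.eventually_gt_atTop (-Real.log ρ)] with δ hδ hδ1 hδ2 F hF
  have hδ0 : 0 < δ := hδ
  have hx : 0 < (Real.log ρ - Real.log δ) / -Real.log β := div_pos (by linarith) hL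
  -- `n` is the largest natural number with `δ < ρ * β ^ n`.
  obtain ⟨n, hn⟩ : ∃ n : ℕ, n + 1 = ⌈(Real.log ρ - Real.log δ) / -Real.log β⌉₊ :=
    ⟨_, Nat.succ_pred_eq_of_pos (Nat.ceil_pos.2 hx)⟩
  have hn1 : (n : ℝ) < (Real.log ρ - Real.log δ) / -Real.log β :=
    Nat.lt_ceil.1 (by omega)
  have hn2 : (Real.log ρ - Real.log δ) / -Real.log β ≤ n + 1 := by
    have := Nat.le_ceil ((Real.log ρ - Real.log δ) / -Real.log β)
    rw [← hn] at this
    exact_mod_cast this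
  have hh : 2 * δ < (1 - β - mu) * β ^ n := by
    have h1 : Real.log δ < Real.log (ρ * β ^ n) := by
      rw [Real.log_mul hρ0.ne' (pow_pos hβ0 n).ne', Real.log_pow]
      rw [lt_div_iff₀ hL] at hn1
      linarith
    have h2 := (Real.log_lt_log_iff hδ0 (mul_pos hρ0 (pow_pos hβ0 n))).1 h1
    have h3 : (1 - β - mu) * β ^ n = 2 * (ρ * β ^ n) := by rw [hρ]; ring
    linarith
  have hbox : IsBoxCover A δ δ F := fun p hp => by
    obtain ⟨c, hc, hpc⟩ := hF p hp
    rw [Prod.dist_eq, max_le_iff, Real.dist_eq, Real.dist_eq] at hpc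
    exact ⟨c, hc, hpc⟩
  have hmain := hA.pow_le_of_isBoxCover hl hlm' hm' hlm n hδ0 hh hbox
  have hθn : 0 < θ ^ n := pow_pos (by linarith) n
  have hc0 : 0 < F.card := by
    rcases Nat.eq_zero_or_pos F.card with h | h
    · rw [h] at hmain
      norm_num at hmain
      linarith
    · exact h
  refine ⟨?_, hc0⟩
  have hlog := Real.log_le_log hθn hmain
  have hc0' : (F.card : ℝ) ≠ 0 := by exact_mod_cast hc0.ne'
  rw [Real.log_pow, Real.log_mul (by positivity) hc0', Real.log_mul two_ne_zero hδ0.ne'] at hlog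
  have hgain : t * (Real.log ρ - Real.log δ) - Real.log θ ≤ n * Real.log θ := by
    have h1 := mul_le_mul_of_nonneg_right hn2 hT.le
    have h2 : (Real.log ρ - Real.log δ) / -Real.log β * Real.log θ
        = t * (Real.log ρ - Real.log δ) := by rw [ht]; ring
    linarith
  rw [div_le_iff₀ (by linarith)] at hδ1
  linarith

theorem theorem2 :
    (∃ lam mu : ℝ, 0 < lam ∧ lam < mu ∧ mu < 1 ∧ 1 < lam + mu ∧
      1 < lowerBoxDim (attractor lam mu)) ∧
    1 < lowerBoxDim (attractor (0.4 : ℝ) (0.9 : ℝ)) := by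
  have h : 1 < lowerBoxDim (attractor (0.4 : ℝ) (0.9 : ℝ)) :=
    (isAttractor_attractor (by norm_num) (by norm_num) (by norm_num)
      (by norm_num)).one_lt_lowerBoxDim (by norm_num) (by norm_num) (by norm_num) (by norm_num)
      (by norm_num) (by norm_num)
  exact ⟨⟨0.4, 0.9, by norm_num, by norm_num, by norm_num, by norm_num, h⟩, h⟩
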